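/- All rings are associative with unit and all modules are unital. Let $M$ be a right module over a ring $R$. A subset $X\subseteq M$ is a weak basis of $M$ if $X$ generates $M$ and $x\notin\operatorname{Span}(X\setminus\{x\})$ for every $x\in X$. The module $M$ is regularly weakly based if every generating set of $M$ contains a weak basis of $M$. The ring $R$ is right perfect if every right $R$-module $M$ has a projective cover, that is, an epimorphism $f\colon P\to M$ with $P$ projective and $\ker f$ superfluous in $P$ (for every submodule $K\le P$, $K+\ker f=P$ implies $K=P$). Proposition. Let $R$ be a ring with Jacobson radical $J$. (1) If all right $R$-modules are regularly weakly based, then $R$ is right perfect. (2) If $R$ is right perfect, then the ring $R/J$ is semisimple, and all right $R$-modules are regularly weakly based if and only if all right $R/J$-modules are regularly weakly based. -/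

import Mathlib

/-! Right modules over a ring `R` are modules over the opposite ring `Rᵐᵒᵖ`. -/

universe u v w

section RightModules

variable (R : Type u) [Ring R] {M : Type w} [AddCommGroup M] [Module Rᵐᵒᵖ M]

/-- `X` is weakly independent: no `x ∈ X` lies in the span of `X \ {x}`. -/
def IsWeaklyIndependent (X : Set M) : Prop :=
  ∀ x ∈ X, x ∉ Submodule.span Rᵐᵒᵖ (X \ {x})

/-- A weak basis of a right module: a weakly independent generating set. -/
def IsWeakBasis (X : Set M) : Prop :=
  Submodule.span Rᵐᵒᵖ X = ⊤ ∧ IsWeaklyIndependent R X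

variable (M) in
/-- A right module is regularly weakly based if each generating set of it contains a weak basis. -/
def IsRegularlyWeaklyBased : Prop :=
  ∀ X : Set M, Submodule.span Rᵐᵒᵖ X = ⊤ → ∃ Y ⊆ X, IsWeakBasis R Y

/-- A submodule `N` is superfluous (small) if `K + N = M` implies `K = M`. -/
def IsSuperfluous (N : Submodule Rᵐᵒᵖ M) : Prop :=
  ∀ K : Submodule Rᵐᵒᵖ M, K ⊔ N = ⊤ → K = ⊤

variable (M) in
/-- A right module has a projective cover: an epimorphism from a projective right module
with superfluous kernel. -/
def HasProjectiveCover : Prop :=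
  ∃ (P : Type w) (_ : AddCommGroup P) (_ : Module Rᵐᵒᵖ P) (f : P →ₗ[Rᵐᵒᵖ] M),
    Module.Projective Rᵐᵒᵖ P ∧ Function.Surjective f ∧ IsSuperfluous R (LinearMap.ker f)

end RightModules

/-- All right `R`-modules (in the universe `w`) are regularly weakly based. -/
def AllRegularlyWeaklyBased (R : Type u) [Ring R] : Prop :=
  ∀ (M : Type w) [AddCommGroup M] [Module Rᵐᵒᵖ M], IsRegularlyWeaklyBased R M

/-- `R` is right perfect: every right `R`-module (in the universe `w`) has a projective cover. -/
def IsRightPerfect (R : Type u) [Ring R] : Prop :=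
  ∀ (M : Type w) [AddCommGroup M] [Module Rᵐᵒᵖ M], HasProjectiveCover R M

/-! Right `R`-modules are left modules over `S = Rᵐᵒᵖ`; let `J` be its radical. (1) Removing one
element from a weak basis leaves a submodule with nonzero cyclic quotient, so every nonzero module
has a maximal submodule and radicals are superfluous. Applied to `S[X]`, this makes `J` nil. Were
`S/J` not semisimple, a direct sum of simple modules would be the union of a non-stabilizing chain
of cyclic submodules, and the generators of that chain contain no weak basis. So idempotents lift
modulo `J` and cover the simple modules; sums of these cover `M/rad M`, and projectivity lifts the
cover to `M`. (2) Projective covers of cyclic modules produce complements in `S/J`. By Bass, nonzero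
projectives have maximal submodules, and covers pass this on to all modules. Radicals are then
superfluous, and weak bases lift from the `R/J`-module `M/rad M`. -/

section RadicalCovers

/-! ### Coatomic modules and nilpotency of radical elements. -/

variable {S : Type u} [Ring S]

/-- Nakayama's lemma with coatomicity in place of finite generation. -/
theorem Submodule.eq_top_of_sup_jacobson_eq_top {M : Type*} [AddCommGroup M] [Module S M]
    [IsCoatomic (Submodule S M)] {K : Submodule S M} (h : K ⊔ Module.jacobson S M = ⊤) :
    K = ⊤ := by
  refine (eq_top_or_exists_le_coatom K).resolve_right ?_
  rintro ⟨m, hm, hK⟩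
  exact hm.1 (top_le_iff.mp (h ▸ sup_le hK (sInf_le hm)))

theorem Submodule.le_jacobson_of_superfluous {M : Type*} [AddCommGroup M] [Module S M]
    {N : Submodule S M} (h : ∀ K : Submodule S M, K ⊔ N = ⊤ → K = ⊤) :
    N ≤ Module.jacobson S M :=
  le_sInf fun m hm ↦ by_contra fun hN ↦
    hm.1 (h m (hm.2 _ (left_lt_sup.mpr hN)))

theorem Submodule.isCoatomic_of_forall_exists_isCoatom
    (h : ∀ (M : Type w) [AddCommGroup M] [Module S M] [Nontrivial M],
      ∃ m : Submodule S M, IsCoatom m)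
    (M : Type w) [AddCommGroup M] [Module S M] : IsCoatomic (Submodule S M) := by
  refine ⟨fun K ↦ or_iff_not_imp_left.mpr fun hK ↦ ?_⟩
  have := Submodule.Quotient.nontrivial_iff.mpr hK
  obtain ⟨m, hm⟩ := h (M ⧸ K)
  exact ⟨m.comap K.mkQ, (Submodule.isCoatom_comap_iff K.mkQ_surjective).mpr hm,
    K.le_comap_mkQ m⟩

/-- If the left module `S[X]` is coatomic, the Jacobson radical of `S` is nil. -/
theorem Ring.isNilpotent_of_mem_jacobson [IsCoatomic (Submodule S (Polynomial S))] {a : S}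
    (ha : a ∈ Ring.jacobson S) : IsNilpotent a := by
  open Polynomial in
  obtain ⟨p, hp⟩ : ∃ p : S[X], p * (1 - C a * X) = 1 := by
    -- Modulo `G`, the monomial `s X^n` equals `s a X^(n+1)`, which lies in the radical of `S[X]`.
    let G : Submodule S S[X] :=
      LinearMap.range ((LinearMap.toSpanSingleton S[X] S[X] (1 - C a * X)).restrictScalars S)
    suffices hG : G = ⊤ from (hG ▸ Submodule.mem_top : (1 : S[X]) ∈ G)
    refine Submodule.eq_top_of_sup_jacobson_eq_top (top_le_iff.mp fun f _ ↦ ?_)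
    induction f using Polynomial.induction_on' with
    | add f g hf hg => exact add_mem (hf trivial) (hg trivial)
    | monomial n s =>
      have : monomial n s = monomial n s * (1 - C a * X) + (s * a) • (X ^ (n + 1) : S[X]) := by
        rw [mul_sub, mul_one, ← mul_assoc, monomial_mul_C, monomial_mul_X, ← C_mul',
          C_mul_X_pow_eq_monomial]
        abel
      rw [this]
      exact Submodule.add_mem_sup ⟨monomial n s, rfl⟩ (Ring.jacobson_smul_top_le S S[X]
        (Submodule.smul_mem_smul (Ideal.mul_mem_left _ s ha) trivial))
  -- `p` is the geometric series of `a X`; being a polynomial, it must terminate.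
  have hcoeff (n : ℕ) : p.coeff n = a ^ n := by
    have h := congrArg (Polynomial.coeff · n) hp
    rw [mul_sub, mul_one, ← mul_assoc] at h
    induction n with
    | zero => simpa using h
    | succ n ih =>
      have ih := ih (congrArg (Polynomial.coeff · n) (by rwa [mul_sub, mul_one, ← mul_assoc] at hp))
      simp only [Polynomial.coeff_sub, Polynomial.coeff_mul_X, Polynomial.coeff_mul_C, ih,
        Polynomial.coeff_one, Nat.add_eq_zero_iff, one_ne_zero, and_false, if_false] at h
      rw [sub_eq_zero.mp h, pow_succ]
  exact ⟨p.natDegree + 1, by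
    rw [← hcoeff, Polynomial.coeff_eq_zero_of_natDegree_lt (Nat.lt_succ_self _)]⟩

/-! ### Radical covers. -/

/-- `M` is a quotient of a projective module by a submodule of its radical. -/
def HasRadicalCover (S : Type u) [Ring S] (M : Type w) [AddCommGroup M] [Module S M] : Prop :=
  ∃ (P : Type v) (_ : AddCommGroup P) (_ : Module S P) (f : P →ₗ[S] M),
    Module.Projective S P ∧ Function.Surjective f ∧ LinearMap.ker f ≤ Module.jacobson S P

theorem HasRadicalCover.congr {M N : Type*} [AddCommGroup M] [Module S M] [AddCommGroup N]
    [Module S N] (e : M ≃ₗ[S] N) (h : HasRadicalCover.{u, v} S M) :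
    HasRadicalCover.{u, v} S N := by
  obtain ⟨P, _, _, f, hP, hf, hk⟩ := h
  exact ⟨P, _, _, e.toLinearMap ∘ₗ f, hP, e.surjective.comp hf, by rwa [LinearEquiv.ker_comp]⟩

/-- Having kernel inside the radical, unlike superfluity, survives infinite direct sums without
further assumptions. -/
theorem HasRadicalCover.dfinsupp {ι : Type w} {M : ι → Type*} [∀ i, AddCommGroup (M i)]
    [∀ i, Module S (M i)] (h : ∀ i, HasRadicalCover.{u, v} S (M i)) :
    HasRadicalCover.{u, max w v} S (Π₀ i, M i) := by
  classical
  choose P _ _ f hP hf hk using h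
  refine ⟨Π₀ i, P i, inferInstance, inferInstance, DFinsupp.mapRange.linearMap f, inferInstance,
    (DFinsupp.mapRange_surjective _ fun i ↦ map_zero (f i)).mpr hf, fun x hx ↦ ?_⟩
  rw [← DFinsupp.sum_single (f := x)]
  refine Submodule.sum_mem _ fun i _ ↦ ?_
  exact Module.map_jacobson_le (DFinsupp.lsingle (R := S) (M := P) i)
    ⟨x i, hk i (by simpa using DFunLike.congr_fun hx i), rfl⟩

/-- If the radical of `S` is nil and `S` is semisimple modulo its radical, each simple
module has a radical cover. -/
theorem IsSimpleModule.hasRadicalCover [IsSemisimpleModule S (S ⧸ Ring.jacobson S)]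
    (hnil : ∀ a ∈ Ring.jacobson S, IsNilpotent a) {T : Type*} [AddCommGroup T] [Module S T]
    [IsSimpleModule S T] : HasRadicalCover.{u, u} S T := by
  set J := Ring.jacobson S
  have := IsSimpleModule.nontrivial S T
  obtain ⟨t, ht⟩ := exists_ne (0 : T)
  let π := LinearMap.toSpanSingleton S T t
  have hπ : Function.Surjective π := IsSimpleModule.toSpanSingleton_surjective S ht
  have hJπ : J ≤ LinearMap.ker π := sInf_le (IsSimpleModule.ker_toSpanSingleton_isMaximal S ht).out
  obtain ⟨C, hC⟩ := exists_isCompl ((LinearMap.ker π).map J.mkQ)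
  have hkC {x : S} (hx : π x = 0) (hxC : J.mkQ x ∈ C) : x ∈ J := by
    have := hC.disjoint.le_bot ⟨⟨x, hx, rfl⟩, hxC⟩
    exact (Submodule.Quotient.mk_eq_zero J).mp this
  -- Modulo `J`, `b` is the component of `1` in the complement `C` of `ker π`. Then `b - b * b` lies
  -- in both summands, so `b` is idempotent modulo `J`; its lift `e` gives the cover `S e`.
  obtain ⟨b, hbC, hb⟩ : ∃ b : S, J.mkQ b ∈ C ∧ π (1 - b) = 0 := by
    have h1 : J.mkQ 1 ∈ (LinearMap.ker π).map J.mkQ ⊔ C := hC.sup_eq_top ▸ trivial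
    obtain ⟨_, ⟨a, ha, rfl⟩, c, hc, h⟩ := Submodule.mem_sup.mp h1
    obtain ⟨c, rfl⟩ := J.mkQ_surjective c
    refine ⟨c, hc, ?_⟩
    have : 1 - c - a ∈ J := by
      rw [← J.ker_mkQ, LinearMap.mem_ker, map_sub, map_sub, ← h]; abel
    have := hJπ this
    rw [LinearMap.mem_ker, map_sub, LinearMap.mem_ker.mp ha, sub_zero] at this
    exact this
  have hidem : IsIdempotentElem (Ideal.Quotient.mk J b) := by
    rw [IsIdempotentElem, ← map_mul, eq_comm, Ideal.Quotient.eq]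
    refine hkC ?_ ?_
    · rw [show b - b * b = b • (1 - b) by rw [smul_eq_mul, mul_sub, mul_one], map_smul, hb,
        smul_zero]
    · rw [show b - b * b = (1 - b) • b by rw [smul_eq_mul, sub_mul, one_mul], map_smul]
      exact C.smul_mem _ hbC
  obtain ⟨e, he, heb⟩ := exists_isIdempotentElem_eq_of_ker_isNilpotent (Ideal.Quotient.mk J)
    (by rwa [Ideal.mk_ker]) _ ⟨b, rfl⟩ hidem
  have heb' : e - b ∈ J := Ideal.Quotient.eq.mp heb
  have heC : J.mkQ e ∈ C := by
    have : J.mkQ e = J.mkQ b := heb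
    rwa [this]
  have he1 : π e = π 1 := by
    have h1 : π (e - b) = 0 := hJπ heb'
    rw [map_sub, sub_eq_zero] at h1 hb
    rw [h1, hb]
  let r : S →ₗ[S] S := LinearMap.toSpanSingleton S S e
  have hr (x : S) (hx : x ∈ LinearMap.range r) : x * e = x := by
    obtain ⟨y, rfl⟩ := hx
    simp [r, mul_assoc, he.eq]
  refine ⟨LinearMap.range r, inferInstance, inferInstance, π ∘ₗ (LinearMap.range r).subtype,
    .of_split (LinearMap.range r).subtype r.rangeRestrict ?_, fun y ↦ ?_, fun x hx ↦ ?_⟩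
  · ext x
    exact hr x x.2
  · obtain ⟨s, rfl⟩ := hπ y
    refine ⟨r.rangeRestrict s, ?_⟩
    change π (s • e) = _
    rw [map_smul, he1, ← map_smul, smul_eq_mul, mul_one]
  · have hxJ : (x : S) ∈ J := by
      refine hkC hx ?_
      rw [← hr x x.2, ← smul_eq_mul, map_smul]
      exact C.smul_mem _ heC
    have : x = r.rangeRestrict x := Subtype.ext (hr x x.2).symm
    rw [this]
    exact Module.map_jacobson_le r.rangeRestrict ⟨x, hxJ, rfl⟩

/-- `J • M` lies in the radical of `M`, so each cyclic submodule of the quotient is an image of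
`S/J`. -/
theorem Module.isSemisimpleModule_quotient_jacobson [IsSemisimpleModule S (S ⧸ Ring.jacobson S)]
    (M : Type*) [AddCommGroup M] [Module S M] :
    IsSemisimpleModule S (M ⧸ Module.jacobson S M) := by
  let f (m : M) : (S ⧸ Ring.jacobson S) →ₗ[S] M ⧸ Module.jacobson S M :=
    Submodule.mapQ _ _ (LinearMap.toSpanSingleton S M m) (Module.le_comap_jacobson _)
  refine isSemisimpleModule_of_isSemisimpleModule_submodule'
    (p := fun m ↦ LinearMap.range (f m)) (fun m ↦ .range _) (top_le_iff.mp fun x _ ↦ ?_)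
  obtain ⟨m, rfl⟩ := Submodule.mkQ_surjective _ x
  exact Submodule.mem_iSup_of_mem m ⟨Submodule.Quotient.mk 1,
    congrArg Submodule.Quotient.mk (one_smul S m)⟩

/-- Projective covers over a ring that is semisimple modulo its radical and whose modules are
coatomic. -/
theorem HasRadicalCover.of_isCoatomic
    (hco : ∀ (M : Type (max u v)) [AddCommGroup M] [Module S M], IsCoatomic (Submodule S M))
    [IsSemisimpleModule S (S ⧸ Ring.jacobson S)]
    (M : Type (max u v)) [AddCommGroup M] [Module S M] :
    HasRadicalCover.{u, max u v} S M := by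
  have : IsCoatomic (Submodule S (Polynomial S)) :=
    (Submodule.orderIsoMapComap
      (ULift.moduleEquiv.{u, u, v} : ULift.{v} (Polynomial S) ≃ₗ[S] _)).isCoatomic_iff.mp (hco _)
  have := hco M
  have := Module.isSemisimpleModule_quotient_jacobson (S := S) M
  obtain ⟨s, e, -, hs⟩ := IsSemisimpleModule.exists_linearEquiv_dfinsupp S
    (M ⧸ Module.jacobson S M)
  obtain ⟨P, _, _, f, hP, hf, hk⟩ := HasRadicalCover.congr e.symm <| HasRadicalCover.dfinsupp
    fun m : s ↦ (IsSimpleModule.hasRadicalCover (S := S) (T := m.1)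
      fun _ ↦ Ring.isNilpotent_of_mem_jacobson)
  -- The lift `g` is onto by Nakayama, and its kernel lies in that of `f`.
  obtain ⟨g, hg⟩ := Module.projective_lifting_property (Module.jacobson S M).mkQ f
    (Submodule.mkQ_surjective _)
  refine ⟨P, _, _, g, hP, ?_, ?_⟩
  · rw [← LinearMap.range_eq_top]
    refine Submodule.eq_top_of_sup_jacobson_eq_top ?_
    rw [← Submodule.ker_mkQ (Module.jacobson S M), ← Submodule.comap_map_eq,
      ← LinearMap.range_comp, hg, LinearMap.range_eq_top.mpr hf, Submodule.comap_top]
  · refine le_trans ?_ hk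
    rw [← hg, LinearMap.ker_comp]
    exact LinearMap.ker_le_comap _

/-! ### Maximal submodules and semisimplicity from projective covers. -/

/-- An endomorphism of a finitely generated projective module with image in the radical has no
nonzero fixed points. -/
theorem LinearMap.eq_zero_of_apply_eq_self_of_range_le_jacobson {M : Type*} [AddCommGroup M]
    [Module S M] [Module.Finite S M] [Module.Projective S M] (f : M →ₗ[S] M)
    (hf : LinearMap.range f ≤ Module.jacobson S M) {x : M} (hx : f x = x) : x = 0 := by
  have surj (g : M →ₗ[S] M) (hg : ∀ y, y - g y ∈ Module.jacobson S M) :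
      Function.Surjective g := by
    rw [← LinearMap.range_eq_top]
    refine Submodule.eq_top_of_sup_jacobson_eq_top (top_le_iff.mp fun y _ ↦ ?_)
    rw [← add_sub_cancel (g y) y]
    exact Submodule.add_mem_sup ⟨y, rfl⟩ (hg y)
  -- A section `k` of `id - f` is again the identity modulo the radical, hence onto; this makes `id
  -- - f` injective.
  obtain ⟨k, hk⟩ := Module.projective_lifting_property (.id - f) .id
    (surj (.id - f) fun y ↦ hf ⟨y, by simp⟩)
  have hk' (y : M) : k y - f (k y) = y := LinearMap.congr_fun hk y
  obtain ⟨y, rfl⟩ := surj k (fun y ↦ by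
    rw [← neg_mem_iff, neg_sub]
    nth_rewrite 2 [← hk' y]
    rw [sub_sub_cancel]
    exact hf ⟨_, rfl⟩) x
  rw [← hk' y, hx, sub_self, map_zero]

/-- A nonzero projective module has a maximal submodule. -/
theorem Module.Projective.exists_isCoatom (P : Type*) [AddCommGroup P] [Module S P]
    [Module.Projective S P] [Nontrivial P] : ∃ m : Submodule S P, IsCoatom m := by
  classical
  by_contra! hno
  have hjac : Module.jacobson S P = ⊤ := by
    rw [Module.jacobson, Set.eq_empty_of_forall_notMem (s := {m | IsCoatom m}) hno, sInf_empty]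
  obtain ⟨i, hi⟩ := (Module.projective_def' (R := S) (P := P)).mp inferInstance
  obtain ⟨p, hp⟩ := exists_ne (0 : P)
  apply hp
  let r := Finsupp.linearCombination S (id : P → P)
  have hri (q : P) : r (i q) = q := LinearMap.congr_fun hi q
  let H := (i p).support
  let ext : (H → S) →ₗ[S] (P →₀ S) :=
    Fintype.linearCombination S (fun h : H ↦ Finsupp.single (h : P) (1 : S))
  let res : (P →₀ S) →ₗ[S] (H → S) := LinearMap.pi fun h ↦ Finsupp.lapply (h : P)
  have hext : ext (res (i p)) = i p := by
    simp only [ext, res, Fintype.linearCombination_apply, LinearMap.pi_apply,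
      Finsupp.lapply_apply, Finsupp.smul_single, smul_eq_mul, mul_one]
    rw [Finset.sum_coe_sort H (fun h ↦ Finsupp.single h (i p h))]
    exact Finsupp.sum_single (i p)
  -- Restricting the projection `i ∘ r` to the finite support of `i p` gives an endomorphism of
  -- `S^H` that fixes `res (i p)`; its image is radical because `P` is its own radical.
  have h0 := LinearMap.eq_zero_of_apply_eq_self_of_range_le_jacobson
    (res ∘ₗ i ∘ₗ r ∘ₗ ext) (x := res (i p)) ?_ ?_
  · rw [← hri p, ← hext, h0, map_zero, map_zero]
  · rintro _ ⟨y, rfl⟩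
    exact Module.map_jacobson_le (res ∘ₗ i) ⟨r (ext y), hjac ▸ trivial, rfl⟩
  · simp only [LinearMap.comp_apply, hext, hri]

/-- If every cyclic module has a projective cover, the ring is semisimple modulo its radical. -/
theorem Ring.isSemisimpleModule_quotient_jacobson_of_projective_cover
    (h : ∀ L : Submodule S S, ∃ (P : Type v) (_ : AddCommGroup P) (_ : Module S P)
      (f : P →ₗ[S] S ⧸ L), Module.Projective S P ∧ Function.Surjective f ∧
      ∀ K : Submodule S P, K ⊔ LinearMap.ker f = ⊤ → K = ⊤) :
    IsSemisimpleModule S (S ⧸ Ring.jacobson S) := by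
  set J := Ring.jacobson S
  rw [isSemisimpleModule_iff]
  refine ⟨fun L ↦ ?_⟩
  let L' := L.comap J.mkQ
  obtain ⟨P, _, _, f, hP, hf, hk⟩ := h L'
  obtain ⟨g, hg⟩ := Module.projective_lifting_property f L'.mkQ hf
  have hfg (x : S) : f (g x) = L'.mkQ x := LinearMap.congr_fun hg x
  have hgs : Function.Surjective g := by
    rw [← LinearMap.range_eq_top]
    refine hk _ ?_
    rw [← Submodule.comap_map_eq, ← LinearMap.range_comp, hg, Submodule.range_mkQ,
      Submodule.comap_top]
  obtain ⟨k, hgk⟩ := Module.projective_lifting_property g .id hgs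
  have hgk' (p : P) : g (k p) = p := LinearMap.congr_fun hgk p
  -- The splitting `s = (s - k (g s)) + k (g s)` has its first term in `L'`. The intersection
  -- vanishes because `ker f` is radical and `k` carries it into `J`.
  refine ⟨(LinearMap.range k).map J.mkQ, ?_⟩
  rw [isCompl_iff, Submodule.disjoint_def, codisjoint_iff]
  refine ⟨?_, top_le_iff.mp fun x _ ↦ ?_⟩
  · rintro _ hx ⟨_, ⟨p, rfl⟩, rfl⟩
    have hp : f p = 0 := by
      rw [← hgk' p, hfg]
      exact (Submodule.Quotient.mk_eq_zero L').mpr hx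
    exact (Submodule.Quotient.mk_eq_zero J).mpr
      (Module.map_jacobson_le k ⟨p, Submodule.le_jacobson_of_superfluous hk hp, rfl⟩)
  · obtain ⟨s, rfl⟩ := J.mkQ_surjective x
    rw [← sub_add_cancel s (k (g s)), map_add]
    refine Submodule.add_mem_sup ?_ ⟨_, ⟨_, rfl⟩, rfl⟩
    refine (Submodule.Quotient.mk_eq_zero L').mp (?_ : L'.mkQ _ = 0)
    rw [← hfg, map_sub, hgk', sub_self, map_zero]

/-- If a nonzero module has a projective cover, it has a maximal submodule. -/
theorem Submodule.exists_isCoatom_of_projective_cover {P M : Type*} [AddCommGroup P] [Module S P]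
    [AddCommGroup M] [Module S M] [Nontrivial M] [Module.Projective S P] (f : P →ₗ[S] M)
    (hf : Function.Surjective f) (hk : ∀ K : Submodule S P, K ⊔ LinearMap.ker f = ⊤ → K = ⊤) :
    ∃ m : Submodule S M, IsCoatom m := by
  have := hf.nontrivial
  obtain ⟨m, hm⟩ := Module.Projective.exists_isCoatom (S := S) P
  exact ⟨m.map f, Submodule.isCoatom_map_of_ker_le hf
    ((Submodule.le_jacobson_of_superfluous hk).trans (sInf_le hm)) hm⟩

end RadicalCovers

/-! ### Weak bases and their lifting. -/

section WeakBases

variable {R : Type u} [Ring R]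

theorem IsRegularlyWeaklyBased.of_equiv {M N : Type*} [AddCommGroup M] [Module Rᵐᵒᵖ M]
    [AddCommGroup N] [Module Rᵐᵒᵖ N] (e : M ≃ₗ[Rᵐᵒᵖ] N) (h : IsRegularlyWeaklyBased R M) :
    IsRegularlyWeaklyBased R N := by
  intro X hX
  have hspan (Z : Set N) : Submodule.span Rᵐᵒᵖ (e.symm '' Z)
      = (Submodule.span Rᵐᵒᵖ Z).map (e.symm : N →ₗ[Rᵐᵒᵖ] M) :=
    (Submodule.map_span (e.symm : N →ₗ[Rᵐᵒᵖ] M) Z).symm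
  obtain ⟨Y, hYX, hY, hYi⟩ := h (e.symm '' X) (by
    rw [hspan, hX, Submodule.map_top, LinearEquiv.range])
  obtain ⟨Y, hYX', rfl⟩ := Set.subset_image_iff.mp hYX
  refine ⟨Y, hYX', ?_, fun y hy hspany ↦ hYi (e.symm y) ⟨y, hy, rfl⟩ ?_⟩
  · rw [hspan] at hY
    rw [← Submodule.map_injective_of_injective e.symm.injective |>.eq_iff, hY, Submodule.map_top,
      LinearEquiv.range]
  · rw [← Set.image_singleton, ← Set.image_sdiff e.symm.injective, hspan]
    exact ⟨y, hspany, rfl⟩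

/-- A nonzero regularly weakly based module has a maximal submodule. -/
theorem IsRegularlyWeaklyBased.exists_isCoatom {M : Type*} [AddCommGroup M] [Module Rᵐᵒᵖ M]
    [Nontrivial M] (h : IsRegularlyWeaklyBased R M) : ∃ m : Submodule Rᵐᵒᵖ M, IsCoatom m := by
  obtain ⟨Y, -, hY, hYi⟩ := h Set.univ Submodule.span_univ
  obtain rfl | ⟨y, hy⟩ := Y.eq_empty_or_nonempty
  · rw [Submodule.span_empty] at hY
    exact absurd hY bot_ne_top
  have hN := hYi y hy
  set N := Submodule.span Rᵐᵒᵖ (Y \ {y})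
  have hsup : N ⊔ Submodule.span Rᵐᵒᵖ {y} = ⊤ := by
    rw [← Submodule.span_union, Set.sdiff_union_of_subset (Set.singleton_subset_iff.mpr hy), hY]
  have : Nontrivial (M ⧸ N) := Submodule.Quotient.nontrivial_iff.mpr fun hN' ↦ hN (hN' ▸ trivial)
  have : Module.Finite Rᵐᵒᵖ (M ⧸ N) := by
    refine ⟨⟨{N.mkQ y}, ?_⟩⟩
    have := congrArg (Submodule.map N.mkQ) hsup
    rwa [Submodule.map_sup, Submodule.mkQ_map_self, bot_sup_eq, Submodule.map_top,
      Submodule.range_mkQ, Submodule.map_span, Set.image_singleton, ← Finset.coe_singleton] at this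
  obtain ⟨m, hm⟩ := IsCoatomic.exists_coatom (α := Submodule Rᵐᵒᵖ (M ⧸ N))
  exact ⟨m.comap N.mkQ, (Submodule.isCoatom_comap_iff N.mkQ_surjective).mpr hm⟩

/-- In a regularly weakly based module, an increasing sequence of cyclic submodules whose union
is the whole module stabilizes. -/
theorem IsRegularlyWeaklyBased.exists_span_singleton_eq_top {M : Type*} [AddCommGroup M]
    [Module Rᵐᵒᵖ M] (h : IsRegularlyWeaklyBased R M) (x : ℕ → M)
    (hmono : Monotone fun n ↦ Submodule.span Rᵐᵒᵖ {x n})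
    (htop : Submodule.span Rᵐᵒᵖ (Set.range x) = ⊤) :
    ∃ n, Submodule.span Rᵐᵒᵖ {x n} = ⊤ := by
  have hmem {i j : ℕ} (hij : i ≤ j) : x i ∈ Submodule.span Rᵐᵒᵖ {x j} :=
    hmono hij (Submodule.mem_span_singleton_self _)
  obtain ⟨Y, hYX, hY, hYi⟩ := h _ htop
  by_cases hbdd : ∃ n, ∀ y ∈ Y, y ∈ Submodule.span Rᵐᵒᵖ {x n}
  · obtain ⟨n, hn⟩ := hbdd
    exact ⟨n, top_le_iff.mp (hY ▸ Submodule.span_le.mpr hn)⟩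
  · push Not at hbdd
    exfalso
    obtain ⟨y, hy, -⟩ := hbdd 0
    obtain ⟨i, rfl⟩ := hYX hy
    obtain ⟨z, hz, hzi⟩ := hbdd i
    obtain ⟨j, rfl⟩ := hYX hz
    -- Of two generators in a chain, one lies in the span of the other, so a weak basis cannot
    -- contain both `x i` and a generator outside its span.
    have hij : i ≤ j := by
      by_contra! hji
      exact hzi (hmem hji.le)
    refine hYi _ hy (Submodule.span_mono ?_ (hmem hij))
    rw [Set.singleton_subset_iff]
    refine ⟨hz, fun heq ↦ hzi ?_⟩
    rw [Set.mem_singleton_iff.mp heq]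
    exact Submodule.mem_span_singleton_self _

/-- A direct sum of a sequence of nonzero cyclic modules which are separated by elements of the
ring is not regularly weakly based. -/
theorem not_isRegularlyWeaklyBased_dfinsupp {T : ℕ → Type*} [∀ i, AddCommGroup (T i)]
    [∀ i, Module Rᵐᵒᵖ (T i)] (y : ∀ i, T i) (hy : ∀ i (z : T i), ∃ a : Rᵐᵒᵖ, a • y i = z)
    (hy0 : ∀ i, y i ≠ 0) (t : ℕ → Rᵐᵒᵖ) (ht : ∀ n, ∀ i < n, t n • y i = 0)
    (ht1 : ∀ n, t n • y n = y n) : ¬ IsRegularlyWeaklyBased R (Π₀ i, T i) := by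
  classical
  intro h
  let s (n : ℕ) : Π₀ i, T i := DFinsupp.single n (y n)
  -- Multiplying `x (n + 1)` by `t n` isolates `s n`, so the spans increase to the whole sum; yet `x
  -- n` has zero `n`-th coordinate, so none is everything.
  let x (n : ℕ) : Π₀ i, T i := ∑ i ∈ Finset.range n, s i
  have hxs (n : ℕ) : x (n + 1) = x n + s n := Finset.sum_range_succ _ _
  have hts (n i : ℕ) (hi : i < n) : t n • s i = 0 := by
    simp only [s, ← DFinsupp.single_smul, ht n i hi, DFinsupp.single_zero]
  have htn (n : ℕ) : t n • s n = s n := by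
    simp only [s, ← DFinsupp.single_smul, ht1]
  have hsx (n : ℕ) : s n ∈ Submodule.span Rᵐᵒᵖ {x (n + 1)} := by
    refine Submodule.mem_span_singleton.mpr ⟨t n, ?_⟩
    rw [hxs, smul_add, htn, Finset.smul_sum,
      Finset.sum_eq_zero fun i hi ↦ hts n i (Finset.mem_range.mp hi), zero_add]
  have hmono : Monotone fun n ↦ Submodule.span Rᵐᵒᵖ {x n} := by
    refine monotone_nat_of_le_succ fun n ↦ ?_
    rw [Submodule.span_singleton_le_iff_mem, ← add_sub_cancel_right (x n) (s n), ← hxs]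
    exact sub_mem (Submodule.mem_span_singleton_self _) (hsx n)
  have htop : Submodule.span Rᵐᵒᵖ (Set.range x) = ⊤ := by
    refine top_le_iff.mp fun z _ ↦ ?_
    rw [← DFinsupp.sum_single (f := z)]
    refine Submodule.sum_mem _ fun i _ ↦ ?_
    obtain ⟨a, ha⟩ := hy i (z i)
    rw [← ha, DFinsupp.single_smul]
    exact Submodule.smul_mem _ _
      (Submodule.span_mono (Set.singleton_subset_iff.mpr (Set.mem_range_self _)) (hsx i))
  obtain ⟨n, hn⟩ := h.exists_span_singleton_eq_top x hmono htop
  obtain ⟨a, ha⟩ := Submodule.mem_span_singleton.mp (hn ▸ Submodule.mem_top : s n ∈ _)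
  have hxn : x n n = 0 := by
    simp only [x, DFinsupp.finsetSum_apply]
    exact Finset.sum_eq_zero fun i hi ↦ DFinsupp.single_eq_of_ne (Finset.mem_range.mp hi).ne'
  have hsn : s n n = 0 := by rw [← ha, DFinsupp.smul_apply, hxn, smul_zero]
  exact hy0 n (by simpa only [s, DFinsupp.single_eq_same] using hsn)

/-- If the direct sums of sequences of cyclic modules are regularly weakly based, the ring is
semisimple modulo its radical. -/
theorem Ring.isSemisimpleModule_quotient_jacobson_of_isRegularlyWeaklyBased
    (h : ∀ (T : ℕ → Type u) [∀ i, AddCommGroup (T i)] [∀ i, Module Rᵐᵒᵖ (T i)],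
      IsRegularlyWeaklyBased R (Π₀ i, T i)) :
    IsSemisimpleModule Rᵐᵒᵖ (Rᵐᵒᵖ ⧸ Ring.jacobson Rᵐᵒᵖ) := by
  classical
  set S := Rᵐᵒᵖ
  let C := {m : Submodule S S // IsCoatom m}
  by_cases hF : ∃ F : Finset C, F.inf Subtype.val ≤ Ring.jacobson S
  · obtain ⟨F, hF⟩ := hF
    have (m : F) : IsSimpleModule S (S ⧸ m.1.1) := isSimpleModule_iff_isCoatom.mpr m.1.2
    let f : S →ₗ[S] Π m : F, S ⧸ m.1.1 := LinearMap.pi fun m ↦ m.1.1.mkQ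
    have hker : LinearMap.ker f = Ring.jacobson S := by
      refine le_antisymm (le_trans ?_ hF) fun x hx ↦ ?_
      · refine fun x hx ↦ (Submodule.mem_finsetInf).mpr fun m hm ↦ ?_
        exact (Submodule.Quotient.mk_eq_zero _).mp (congrFun hx ⟨m, hm⟩)
      · exact funext fun m ↦ (Submodule.Quotient.mk_eq_zero _).mpr
          (sInf_le (a := m.1.1) m.1.2 hx)
    exact .of_injective ((Ring.jacobson S).liftQ f hker.ge)
      (LinearMap.ker_eq_bot.mp (Submodule.ker_liftQ_eq_bot' _ _ hker.symm))
  · exfalso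
    have hnext (F : Finset C) : ∃ c : C, ¬ F.inf Subtype.val ≤ c.1 := by
      by_contra! hc
      exact hF ⟨F, le_sInf fun m hm ↦ hc ⟨m, hm⟩⟩
    choose g hg using hnext
    -- Greedy choice: each new maximal ideal fails to contain the intersection of the earlier ones,
    -- which yields the separating elements `t n`.
    let F (n : ℕ) : Finset C := Nat.rec ∅ (fun _ F ↦ insert (g F) F) n
    have hFmono : Monotone F := monotone_nat_of_le_succ fun n ↦ Finset.subset_insert _ _
    let m (n : ℕ) : Submodule S S := (g (F n)).1
    have hm (n : ℕ) : IsCoatom (m n) := (g (F n)).2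
    have hmF {i n : ℕ} (hin : i < n) : (F n).inf Subtype.val ≤ m i :=
      Finset.inf_le (hFmono (Nat.succ_le_of_lt hin) (Finset.mem_insert_self _ _))
    have hsep (n : ℕ) : ∃ t : S, (∀ i < n, t ∈ m i) ∧ 1 - t ∈ m n := by
      have hsup : m n ⊔ (F n).inf Subtype.val = ⊤ := (hm n).2 _ (left_lt_sup.mpr (hg (F n)))
      obtain ⟨a, ha, t, ht, hat⟩ :=
        Submodule.mem_sup.mp (hsup ▸ Submodule.mem_top : (1 : S) ∈ _)
      exact ⟨t, fun i hi ↦ hmF hi ht, by rwa [← hat, add_sub_cancel_right]⟩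
    choose t ht ht1 using hsep
    refine not_isRegularlyWeaklyBased_dfinsupp (R := R) (T := fun i ↦ S ⧸ m i)
      (fun i ↦ (m i).mkQ 1) (fun i z ↦ ?_) (fun i h0 ↦ ?_) t (fun n i hi ↦ ?_) (fun n ↦ ?_) (h _)
    · obtain ⟨a, rfl⟩ := (m i).mkQ_surjective z
      exact ⟨a, by rw [← map_smul, smul_eq_mul, mul_one]⟩
    · exact (hm i).1 ((Ideal.eq_top_iff_one _).mpr ((Submodule.Quotient.mk_eq_zero _).mp h0))
    · rw [← map_smul, smul_eq_mul, mul_one]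
      exact (Submodule.Quotient.mk_eq_zero _).mpr (ht n i hi)
    · rw [← map_smul, smul_eq_mul, mul_one]
      exact ((Submodule.Quotient.eq _).mpr (ht1 n)).symm

theorem Submodule.mem_span_iff_of_surjective {S T : Type*} [Ring S] [Ring T] (φ : S →+* T)
    (hφ : Function.Surjective φ) {M : Type*} [AddCommGroup M] [Module S M] [Module T M]
    (hsmul : ∀ (s : S) (m : M), s • m = φ s • m) (X : Set M) (x : M) :
    x ∈ Submodule.span S X ↔ x ∈ Submodule.span T X := by
  constructor <;> intro hx
  · induction hx using Submodule.span_induction with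
    | mem x hx => exact Submodule.subset_span hx
    | zero => exact zero_mem _
    | add x y _ _ hx hy => exact add_mem hx hy
    | smul a x _ hx => exact hsmul a x ▸ Submodule.smul_mem _ _ hx
  · induction hx using Submodule.span_induction with
    | mem x hx => exact Submodule.subset_span hx
    | zero => exact zero_mem _
    | add x y _ _ hx hy => exact add_mem hx hy
    | smul a x _ hx =>
      obtain ⟨a, rfl⟩ := hφ a
      exact hsmul a x ▸ Submodule.smul_mem _ _ hx

/-- Being regularly weakly based does not depend on the choice between a ring and a quotient of it
acting on the module. -/
theorem isRegularlyWeaklyBased_iff_of_surjective {R' : Type*} [Ring R'] (φ : Rᵐᵒᵖ →+* R'ᵐᵒᵖ)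
    (hφ : Function.Surjective φ) {M : Type*} [AddCommGroup M] [Module Rᵐᵒᵖ M] [Module R'ᵐᵒᵖ M]
    (hsmul : ∀ (s : Rᵐᵒᵖ) (m : M), s • m = φ s • m) :
    IsRegularlyWeaklyBased R M ↔ IsRegularlyWeaklyBased R' M := by
  simp only [IsRegularlyWeaklyBased, IsWeakBasis, IsWeaklyIndependent, Submodule.eq_top_iff',
    Submodule.mem_span_iff_of_surjective φ hφ hsmul]

/-- Weak bases lift modulo a superfluous submodule. -/
theorem IsRegularlyWeaklyBased.of_quotient {M : Type*} [AddCommGroup M] [Module Rᵐᵒᵖ M]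
    (N : Submodule Rᵐᵒᵖ M) (hN : IsSuperfluous R N) (h : IsRegularlyWeaklyBased R (M ⧸ N)) :
    IsRegularlyWeaklyBased R M := by
  intro X hX
  obtain ⟨Z, hZX, hZ, hZi⟩ := h (N.mkQ '' X) (by
    rw [← Submodule.map_span, hX, Submodule.map_top, Submodule.range_mkQ])
  -- One preimage per element of `Z`, so that deleting `y` from `Y` deletes exactly its image from
  -- `Z`.
  obtain ⟨Y, hYX, hbij⟩ := (Set.surjOn_image N.mkQ X).mono subset_rfl hZX |>.exists_bijOn_subset
  have himage := hbij.image_eq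
  have hspanY : Submodule.span Rᵐᵒᵖ Y ⊔ LinearMap.ker N.mkQ = ⊤ := by
    rw [← Submodule.comap_map_eq, Submodule.map_span, himage, hZ, Submodule.comap_top]
  refine ⟨Y, hYX, hN _ (N.ker_mkQ ▸ hspanY), fun y hy hspan ↦ hZi (N.mkQ y) (hbij.mapsTo hy) ?_⟩
  have hdiff : N.mkQ '' (Y \ {y}) = Z \ {N.mkQ y} := by
    rw [← Set.image_singleton, ← himage, hbij.injOn.image_sdiff_subset
        (Set.singleton_subset_iff.mpr hy)]
  rw [← hdiff, ← Submodule.map_span]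
  exact ⟨y, hspan, rfl⟩

end WeakBases

/-! ### Symmetry of the radical and change of rings. -/

/-- The Jacobson radical is left-right symmetric. -/
theorem Ring.op_mem_jacobson {R : Type*} [Ring R] {x : R} (hx : x ∈ Ring.jacobson R) :
    MulOpposite.op x ∈ Ring.jacobson Rᵐᵒᵖ := by
  have hleft (a : R) (ha : a ∈ Ring.jacobson R) : ∃ z, z * (1 + a) = 1 := by
    rw [← Ideal.jacobson_bot] at ha
    obtain ⟨z, hz⟩ := Ideal.exists_mul_add_sub_mem_of_mem_jacobson a ha
    exact ⟨z, by rw [add_comm]; simpa [sub_eq_zero] using hz⟩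
  rw [← Ideal.jacobson_bot, Ideal.mem_jacobson_iff]
  intro y
  have hxy : x * y.unop ∈ Ring.jacobson R := Ideal.mul_mem_right _ _ hx
  obtain ⟨z, hz⟩ := hleft _ hxy
  -- The opposite ring asks for a right inverse of `1 + x * y.unop`. Its left inverse `z` is also
  -- `1` plus a radical element, hence left invertible, hence a two-sided inverse.
  have hz1 : z = 1 + -(z * (x * y.unop)) := by
    rw [← hz]; noncomm_ring
  obtain ⟨z', hz'⟩ := hleft _ (neg_mem (Ideal.mul_mem_left _ z hxy))
  rw [← hz1] at hz'
  have hz'' : z' = 1 + x * y.unop := left_inv_eq_right_inv hz' hz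
  refine ⟨MulOpposite.op z, ?_⟩
  rw [Ideal.mem_bot, ← MulOpposite.unop_inj]
  simp only [MulOpposite.unop_sub, MulOpposite.unop_add, MulOpposite.unop_mul,
    MulOpposite.unop_op, MulOpposite.unop_one, MulOpposite.unop_zero]
  rw [← hz', hz'']
  noncomm_ring

/-- Reconciles `R/J`, formed with the radical of `R`, with the radical of `Rᵐᵒᵖ` that right modules
see. -/
theorem Ring.ker_op_quotient_mk_jacobson (R : Type*) [Ring R] :
    RingHom.ker (Ideal.Quotient.mk (Ring.jacobson R)).op = Ring.jacobson Rᵐᵒᵖ := by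
  ext x
  have h1 : x ∈ RingHom.ker (Ideal.Quotient.mk (Ring.jacobson R)).op ↔
      x.unop ∈ Ring.jacobson R := by
    rw [RingHom.mem_ker, ← Ideal.Quotient.eq_zero_iff_mem, ← MulOpposite.unop_inj]
    rfl
  rw [h1]
  refine ⟨fun h ↦ Ring.op_mem_jacobson h, fun h ↦ ?_⟩
  exact Ring.le_comap_jacobson ((RingEquiv.opOp R).symm : Rᵐᵒᵖᵐᵒᵖ →+* R) (Ring.op_mem_jacobson h)

/-- A module over the domain of a surjective ring homomorphism whose kernel acts trivially is a
module over the codomain. -/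
theorem Module.exists_of_surjective {S T : Type*} [Ring S] [Ring T] (φ : S →+* T)
    (hφ : Function.Surjective φ) {M : Type*} [AddCommGroup M] [Module S M]
    (hker : ∀ s ∈ RingHom.ker φ, ∀ m : M, s • m = 0) :
    ∃ _ : Module T M, ∀ (s : S) (m : M), s • m = φ s • m := by
  let ψ : T →+* AddMonoid.End M := RingHom.liftOfSurjective φ hφ ⟨Module.toAddMonoidEnd S M,
    fun s hs ↦ AddMonoidHom.ext (hker s hs)⟩
  refine ⟨Module.compHom M ψ, fun s m ↦ ?_⟩
  change _ = ψ (φ s) m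
  rw [RingHom.liftOfSurjective_comp_apply]
  rfl

theorem IsSemisimpleRing.of_surjective_of_ker_eq {S T : Type*} [Ring S] [Ring T] (φ : S →+* T)
    (hφ : Function.Surjective φ) {I : Ideal S} (hker : RingHom.ker φ = I)
    [IsSemisimpleModule S (S ⧸ I)] : IsSemisimpleRing T := by
  have : RingHomSurjective φ := ⟨hφ⟩
  let l : (S ⧸ I) →ₛₗ[φ] T := Submodule.liftQ I φ.toSemilinearMap hker.ge
  refine (l.isSemisimpleModule_iff_of_bijective ⟨?_, ?_⟩).mp inferInstance
  · exact LinearMap.ker_eq_bot.mp (Submodule.ker_liftQ_eq_bot' _ _ hker.symm)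
  · intro y
    obtain ⟨x, rfl⟩ := hφ y
    exact ⟨Submodule.Quotient.mk x, rfl⟩

/-! ### The two halves of the proposition. -/

theorem AllRegularlyWeaklyBased.isRightPerfect {R : Type u} [Ring R]
    (h : AllRegularlyWeaklyBased.{u, max u v} R) : IsRightPerfect.{u, max u v} R := by
  have hco : ∀ (M : Type max u v) [AddCommGroup M] [Module Rᵐᵒᵖ M],
      IsCoatomic (Submodule Rᵐᵒᵖ M) :=
    Submodule.isCoatomic_of_forall_exists_isCoatom fun M _ _ _ ↦ (h M).exists_isCoatom
  have := Ring.isSemisimpleModule_quotient_jacobson_of_isRegularlyWeaklyBased (R := R)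
    fun T _ _ ↦ (h (ULift.{v} (Π₀ i, T i))).of_equiv ULift.moduleEquiv
  intro M _ _
  obtain ⟨P, _, _, f, hP, hf, hk⟩ := HasRadicalCover.of_isCoatomic.{u, v} hco M
  have := hco P
  exact ⟨P, _, _, f, hP, hf, fun K hK ↦ Submodule.eq_top_of_sup_jacobson_eq_top
    (top_le_iff.mp (hK ▸ sup_le_sup_left hk K))⟩

theorem IsRightPerfect.isSemisimpleRing_quotient_jacobson {R : Type u} [Ring R]
    (h : IsRightPerfect.{u, max u v} R) : IsSemisimpleRing (R ⧸ Ring.jacobson R) := by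
  have : IsSemisimpleModule Rᵐᵒᵖ (Rᵐᵒᵖ ⧸ Ring.jacobson Rᵐᵒᵖ) := by
    refine Ring.isSemisimpleModule_quotient_jacobson_of_projective_cover.{u, max u v} fun L ↦ ?_
    obtain ⟨P, _, _, f, hP, hf, hk⟩ := h (ULift.{v} (Rᵐᵒᵖ ⧸ L))
    let e : ULift.{v} (Rᵐᵒᵖ ⧸ L) ≃ₗ[Rᵐᵒᵖ] Rᵐᵒᵖ ⧸ L := ULift.moduleEquiv
    exact ⟨P, _, _, e.toLinearMap ∘ₗ f, hP, e.surjective.comp hf, by rwa [LinearEquiv.ker_comp]⟩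
  have := IsSemisimpleRing.of_surjective_of_ker_eq (Ideal.Quotient.mk (Ring.jacobson R)).op
    (MulOpposite.op_surjective.comp (Ideal.Quotient.mk_surjective.comp MulOpposite.unop_surjective))
    (Ring.ker_op_quotient_mk_jacobson R)
  exact isSemisimpleRing_mulOpposite_iff.mp this

/-- Maximal submodules of projective covers push forward, so every module is coatomic and Nakayama
applies. -/
theorem IsRightPerfect.isSuperfluous_jacobson {R : Type u} [Ring R]
    (h : IsRightPerfect.{u, w} R) (M : Type w) [AddCommGroup M] [Module Rᵐᵒᵖ M] :
    IsSuperfluous R (Module.jacobson Rᵐᵒᵖ M) := by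
  have : IsCoatomic (Submodule Rᵐᵒᵖ M) := by
    refine Submodule.isCoatomic_of_forall_exists_isCoatom (fun N _ _ _ ↦ ?_) M
    obtain ⟨P, _, _, f, hP, hf, hk⟩ := h N
    exact Submodule.exists_isCoatom_of_projective_cover f hf hk
  exact fun K ↦ Submodule.eq_top_of_sup_jacobson_eq_top

theorem IsRightPerfect.allRegularlyWeaklyBased_iff {R : Type u} [Ring R]
    (h : IsRightPerfect.{u, w} R) :
    AllRegularlyWeaklyBased.{u, w} R ↔ AllRegularlyWeaklyBased.{u, w} (R ⧸ Ring.jacobson R) := by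
  let φ := (Ideal.Quotient.mk (Ring.jacobson R)).op
  have hφ : Function.Surjective φ :=
    MulOpposite.op_surjective.comp (Ideal.Quotient.mk_surjective.comp MulOpposite.unop_surjective)
  refine ⟨fun hR M _ _ ↦ ?_, fun hR M _ _ ↦ ?_⟩
  · let _ : Module Rᵐᵒᵖ M := Module.compHom M φ
    exact (isRegularlyWeaklyBased_iff_of_surjective φ hφ fun _ _ ↦ rfl).mp (hR M)
  · refine .of_quotient _ (h.isSuperfluous_jacobson M) ?_
    obtain ⟨_, hsmul⟩ := Module.exists_of_surjective φ hφ
      (M := M ⧸ Module.jacobson Rᵐᵒᵖ M) (fun s hs m ↦ by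
        obtain ⟨m, rfl⟩ := Submodule.mkQ_surjective _ m
        rw [← map_smul]
        refine (Submodule.Quotient.mk_eq_zero _).mpr (Ring.jacobson_smul_top_le Rᵐᵒᵖ M ?_)
        exact Submodule.smul_mem_smul (Ring.ker_op_quotient_mk_jacobson R ▸ hs) trivial)
    exact (isRegularlyWeaklyBased_iff_of_surjective φ hφ hsmul).mpr (hR _)

theorem proposition2p4 (R : Type u) [Ring R] :
    (AllRegularlyWeaklyBased.{u, max u v} R → IsRightPerfect.{u, max u v} R) ∧
    (IsRightPerfect.{u, max u v} R →
      IsSemisimpleRing (R ⧸ Ring.jacobson R) ∧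
      (AllRegularlyWeaklyBased.{u, max u v} R ↔
        AllRegularlyWeaklyBased.{u, max u v} (R ⧸ Ring.jacobson R))) :=
  ⟨fun h ↦ AllRegularlyWeaklyBased.isRightPerfect.{u, v} h, fun h ↦
    ⟨IsRightPerfect.isSemisimpleRing_quotient_jacobson.{u, v} h, h.allRegularlyWeaklyBased_iff⟩⟩
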